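/- Let $p$ be a prime. All subgroups below are closed, and for a pro-$p$ group $H$ write $H^{\mathrm{ab}}=H/\mathrm{cl}([H,H])$, an abelian pro-$p$ group with its canonical $\mathbb{Z}_p$-module structure, and $\mathrm{tf}(H)=\dim_{\mathbb{Q}_p}(\mathbb{Q}_p\otimes_{\mathbb{Z}_p}H^{\mathrm{ab}})$. For an open normal subgroup $N$ of $H$ let $i_{H,N}\colon H^{\mathrm{ab}}\to N^{\mathrm{ab}}$ be the transfer; its image lies in the invariants $(N^{\mathrm{ab}})^{H/N}$ of the conjugation action. Let $\mathbf{tk}(H/N)=\ker(i_{H,N})$, $\mathbf{tc}(H/N)=\mathrm{coker}\big(H^{\mathrm{ab}}\to (N^{\mathrm{ab}})^{H/N}\big)$ and, when both are finite, $\rho(H/N)=|\mathbf{tk}(H/N)|/|\mathbf{tc}(H/N)|$ (the transfer ratio). Let $G$ be a (topologically) finitely generated pro-$p$ group of global tf-rank, i.e. $\mathrm{tf}(U)=\mathrm{tf}(G)$ for every open subgroup $U$ of $G$, and write $\mathrm{gtf}(G)=\mathrm{tf}(G)$ for the common value. Let $(U,V)$ be any open $p$-section of $G$, i.e. a pair of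 open subgroups $V\subseteq U$ of $G$ with $|U:V|=p$ (so that $V$ is normal in $U$). Then $\mathbf{tk}(U/V)$ and $\mathbf{tc}(U/V)$ are finite and $$\mathrm{gtf}(G)=1-\log_p(\rho(U/V))\geq 0 .$$ In particular, $\rho(U/V)$ is the same for all open $p$-sections $(U,V)$ of $G$. -/

import Mathlib

open Filter Topology

set_option linter.unusedSectionVars false

/-! ### Pro-`p` groups -/

/-- Over a compact, Hausdorff, totally disconnected topological group `G` (a profinite group),
this says that `G` is a pro-`p` group: every open normal subgroup has a `p`-group as quotient. -/
class IsProP (p : ℕ) (G : Type*) [Group G] [TopologicalSpace G] : Prop where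
  isPGroup_quotient : ∀ (N : Subgroup G) [N.Normal], IsOpen (N : Set G) → IsPGroup p (G ⧸ N)

/-- Topological finite generation: some finite subset generates a dense subgroup. -/
def TopologicallyFG (G : Type*) [Group G] [TopologicalSpace G] : Prop :=
  ∃ S : Set G, S.Finite ∧ Dense (Subgroup.closure S : Set G)

section Inheritance

variable {G : Type*} [Group G] [TopologicalSpace G] [IsTopologicalGroup G] [CompactSpace G]
  [T2Space G] [TotallyDisconnectedSpace G]

instance OpenSubgroup.compactSpace_toSubgroup (U : OpenSubgroup G) :
    CompactSpace U.toSubgroup :=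
  isCompact_iff_compactSpace.mp U.isClosed.isCompact

instance OpenSubgroup.isProP_toSubgroup (p : ℕ) [IsProP p G] (U : OpenSubgroup G) :
    IsProP p U.toSubgroup where
  isPGroup_quotient := by
    intro N hN hNo
    have h1 : IsOpen ((N.map U.toSubgroup.subtype : Subgroup G) : Set G) := by
      exact (U.isOpen.isOpenEmbedding_subtypeVal).isOpenMap _ hNo
    obtain ⟨M, hM⟩ := ProfiniteGrp.exist_openNormalSubgroup_sub_open_nhds_of_one h1
      (Subgroup.one_mem _)
    have hq := IsProP.isPGroup_quotient (p := p) M.toSubgroup M.isOpen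
    intro x
    obtain ⟨u, rfl⟩ := QuotientGroup.mk_surjective x
    obtain ⟨k, hk⟩ := hq (QuotientGroup.mk (u : G))
    refine ⟨k, ?_⟩
    rw [← QuotientGroup.mk_pow, QuotientGroup.eq_one_iff] at hk ⊢
    obtain ⟨y, hy, hy'⟩ := hM hk
    have : y = u ^ p ^ k := Subtype.ext hy'
    exact this ▸ hy

variable (N : Subgroup G) [N.Normal]

instance QuotientGroup.isProP (p : ℕ) [IsProP p G] : IsProP p (G ⧸ N) where
  isPGroup_quotient := by
    intro M hM hMo
    have hq := IsProP.isPGroup_quotient (p := p) (M.comap (QuotientGroup.mk' N))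
      (hMo.preimage QuotientGroup.continuous_mk)
    intro x
    obtain ⟨y, rfl⟩ := QuotientGroup.mk_surjective x
    obtain ⟨g, rfl⟩ := QuotientGroup.mk_surjective y
    obtain ⟨k, hk⟩ := hq (QuotientGroup.mk g)
    refine ⟨k, ?_⟩
    rw [← QuotientGroup.mk_pow, QuotientGroup.eq_one_iff] at hk ⊢
    exact hk

instance TopologicalAbelianization.t2Space : T2Space (TopologicalAbelianization G) := by
  have : IsClosed ((commutator G).topologicalClosure : Set G) :=
    Subgroup.isClosed_topologicalClosure _
  infer_instance

instance TopologicalAbelianization.t2Space_additive :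
    T2Space (Additive (TopologicalAbelianization G)) :=
  inferInstanceAs (T2Space (TopologicalAbelianization G))

/-- Open normal subgroups of a quotient of a profinite group form a basis of neighbourhoods of the identity. -/
theorem QuotientGroup.exists_open_subgroup_subset {s : Set (G ⧸ N)} (hs : s ∈ 𝓝 (1 : G ⧸ N)) :
    ∃ M : Subgroup (G ⧸ N), M.Normal ∧ IsOpen (M : Set (G ⧸ N)) ∧ (M : Set (G ⧸ N)) ⊆ s := by
  obtain ⟨t, hts, hto, ht1⟩ := mem_nhds_iff.mp hs
  obtain ⟨M, hM⟩ := ProfiniteGrp.exist_openNormalSubgroup_sub_open_nhds_of_one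
    (hto.preimage (QuotientGroup.continuous_mk (N := N))) ht1
  refine ⟨M.toSubgroup.map (QuotientGroup.mk' N),
    Subgroup.Normal.map inferInstance _ (QuotientGroup.mk'_surjective N), ?_, ?_⟩
  · exact QuotientGroup.isOpenMap_coe _ M.isOpen
  · rintro _ ⟨g, hg, rfl⟩
    exact hts (hM hg)

end Inheritance

/-! ### The `ℤ_[p]`-module structure of an abelian pro-`p` group -/

section PadicModule

variable (p : ℕ) [Fact p.Prime]

/-- The filter of integers converging `p`-adically to `z`. -/
noncomputable def padicApprox (z : ℤ_[p]) : Filter ℤ := comap (Int.cast : ℤ → ℤ_[p]) (𝓝 z)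

instance padicApprox_neBot (z : ℤ_[p]) : (padicApprox p z).NeBot := by
  refine comap_neBot fun t ht => ?_
  obtain ⟨_, hx, m, rfl⟩ := mem_closure_iff_nhds.mp (PadicInt.denseRange_intCast z) t ht
  exact ⟨m, hx⟩

theorem padicApprox_eventually (z : ℤ_[p]) (k : ℕ) :
    ∀ᶠ m in padicApprox p z, ‖z - ((m : ℤ) : ℤ_[p])‖ ≤ (p : ℝ) ^ (-(k : ℤ)) := by
  have hp : (0 : ℝ) < (p : ℝ) ^ (-(k : ℤ)) :=
    zpow_pos (by exact_mod_cast (Fact.out : p.Prime).pos) _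
  have := (Metric.closedBall_mem_nhds z hp)
  refine mem_of_superset (preimage_mem_comap this) ?_
  intro m hm
  simpa [dist_eq_norm, norm_sub_rev] using hm

variable (M : Type*) [AddCommGroup M] [TopologicalSpace M]

/-- The additive form of the condition that the open subgroups of `p`-power exponent quotient
form a basis of neighbourhoods of the identity. -/
def HasPPowerBasis : Prop :=
  ∀ s ∈ 𝓝 (0 : M), ∃ N : AddSubgroup M, IsOpen (N : Set M) ∧ (N : Set M) ⊆ s ∧
    ∃ k : ℕ, ∀ x : M, p ^ k • x ∈ N

variable {p M}

theorem HasPPowerBasis.zsmul_sub_mem {N : AddSubgroup M} {k : ℕ}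
    (hk : ∀ x : M, p ^ k • x ∈ N) {z : ℤ_[p]} {m n : ℤ}
    (hm : ‖z - (m : ℤ_[p])‖ ≤ (p : ℝ) ^ (-(k : ℤ)))
    (hn : ‖z - (n : ℤ_[p])‖ ≤ (p : ℝ) ^ (-(k : ℤ))) (a : M) :
    m • a - n • a ∈ N := by
  have h : ‖((m - n : ℤ) : ℤ_[p])‖ ≤ (p : ℝ) ^ (-(k : ℤ)) := by
    have : ((m - n : ℤ) : ℤ_[p]) = (z - n) - (z - m) := by push_cast; ring
    rw [this, sub_eq_add_neg]
    refine (PadicInt.nonarchimedean _ _).trans ?_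
    rw [norm_neg]
    exact max_le hn hm
  rw [PadicInt.norm_int_le_pow_iff_dvd] at h
  obtain ⟨c, hc⟩ := h
  rw [← sub_smul, hc, mul_smul]
  have := hk (c • a)
  rw [← natCast_zsmul] at this
  exact_mod_cast this

variable [IsTopologicalAddGroup M] [CompactSpace M]

theorem HasPPowerBasis.exists_tendsto (h : HasPPowerBasis p M) (z : ℤ_[p]) (a : M) :
    ∃ b : M, Tendsto (fun m : ℤ => m • a) (padicApprox p z) (𝓝 b) := by
  obtain ⟨b, hb⟩ := exists_clusterPt_of_compactSpace (map (fun m : ℤ => m • a) (padicApprox p z))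
  refine ⟨b, ?_⟩
  intro s hs
  have hs' : (fun x => x + b) ⁻¹' s ∈ 𝓝 (0 : M) := by
    refine (continuous_add_const b).continuousAt ?_
    simpa using hs
  obtain ⟨N, hNo, hNs, k, hk⟩ := h _ hs'
  have hev := padicApprox_eventually p z k
  have hNb : {x : M | x - b ∈ N} ∈ 𝓝 b := by
    have : IsOpen {x : M | x - b ∈ N} := hNo.preimage (continuous_sub_right b)
    exact this.mem_nhds (by simp [N.zero_mem])
  have hfr := (mapClusterPt_iff_frequently.mp hb) _ hNb
  obtain ⟨n, hn1, hn2⟩ := (hfr.and_eventually hev).exists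
  rw [mem_map]
  filter_upwards [hev] with m hm
  have h1 := N.add_mem (HasPPowerBasis.zsmul_sub_mem hk hm hn2 a) hn1
  have h2 : m • a - b ∈ N := by simpa using h1
  simpa using hNs h2

/-- `z • a` is the limit of `m • a` for integers `m` converging `p`-adically to `z`. -/
noncomputable def HasPPowerBasis.smul (h : HasPPowerBasis p M) (z : ℤ_[p]) (a : M) : M :=
  Classical.choose (h.exists_tendsto z a)

theorem HasPPowerBasis.tendsto_smul (h : HasPPowerBasis p M) (z : ℤ_[p]) (a : M) :
    Tendsto (fun m : ℤ => m • a) (padicApprox p z) (𝓝 (h.smul z a)) :=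
  Classical.choose_spec (h.exists_tendsto z a)

theorem HasPPowerBasis.smul_sub_zsmul_mem (h : HasPPowerBasis p M) {N : AddSubgroup M}
    (hN : IsOpen (N : Set M)) {k : ℕ} (hk : ∀ x : M, p ^ k • x ∈ N) {z : ℤ_[p]} {m : ℤ}
    (hm : ‖z - (m : ℤ_[p])‖ ≤ (p : ℝ) ^ (-(k : ℤ))) (a : M) : h.smul z a - m • a ∈ N := by
  have hc : IsClosed (N : Set M) := N.isClosed_of_isOpen hN
  refine hc.mem_of_tendsto ((h.tendsto_smul z a).sub_const (m • a)) ?_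
  filter_upwards [padicApprox_eventually p z k] with n hn
  exact HasPPowerBasis.zsmul_sub_mem hk hn hm a

variable [T2Space M]

theorem HasPPowerBasis.eq_smul (h : HasPPowerBasis p M) {ι : Type*} {l : Filter ι} [l.NeBot]
    {f : ι → ℤ} {z : ℤ_[p]} (hf : Tendsto (fun i => ((f i : ℤ) : ℤ_[p])) l (𝓝 z)) {a b : M}
    (hb : Tendsto (fun i => f i • a) l (𝓝 b)) : b = h.smul z a :=
  tendsto_nhds_unique hb ((h.tendsto_smul z a).comp (tendsto_comap_iff.mpr hf))

theorem tendsto_intCast_padicApprox (z : ℤ_[p]) :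
    Tendsto (Int.cast : ℤ → ℤ_[p]) (padicApprox p z) (𝓝 z) := tendsto_comap

theorem HasPPowerBasis.intCast_smul (h : HasPPowerBasis p M) (m : ℤ) (a : M) :
    h.smul (m : ℤ_[p]) a = m • a :=
  (h.eq_smul (l := (pure m : Filter ℤ)) (f := id) (tendsto_pure_nhds _ _)
    (tendsto_pure_nhds _ _)).symm

theorem HasPPowerBasis.add_smul' (h : HasPPowerBasis p M) (z w : ℤ_[p]) (a : M) :
    h.smul (z + w) a = h.smul z a + h.smul w a := by
  refine (h.eq_smul (l := padicApprox p z ×ˢ padicApprox p w) (f := fun q => q.1 + q.2) ?_ ?_).symm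
  · push_cast
    exact ((tendsto_intCast_padicApprox z).comp tendsto_fst).add
      ((tendsto_intCast_padicApprox w).comp tendsto_snd)
  · simp_rw [add_smul]
    exact ((h.tendsto_smul z a).comp tendsto_fst).add ((h.tendsto_smul w a).comp tendsto_snd)

theorem HasPPowerBasis.smul_add' (h : HasPPowerBasis p M) (z : ℤ_[p]) (a b : M) :
    h.smul z (a + b) = h.smul z a + h.smul z b := by
  refine (h.eq_smul (l := padicApprox p z) (f := id) (tendsto_intCast_padicApprox z) ?_).symm
  simp_rw [smul_add]
  exact (h.tendsto_smul z a).add (h.tendsto_smul z b)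

theorem HasPPowerBasis.continuous_smul (h : HasPPowerBasis p M) (a : M) :
    Continuous (fun z : ℤ_[p] => h.smul z a) := by
  let f : ℤ_[p] →+ M := AddMonoidHom.mk' (fun z => h.smul z a) fun z w => h.add_smul' z w a
  refine continuous_of_continuousAt_zero f ?_
  intro s hs
  rw [map_zero] at hs
  obtain ⟨N, hNo, hNs, k, hk⟩ := h _ hs
  have hp : (0 : ℝ) < (p : ℝ) ^ (-(k : ℤ)) :=
    zpow_pos (by exact_mod_cast (Fact.out : p.Prime).pos) _
  rw [mem_map]
  filter_upwards [Metric.closedBall_mem_nhds (0 : ℤ_[p]) hp] with z hz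
  apply hNs
  have := h.smul_sub_zsmul_mem hNo hk (z := z) (m := 0) (by simpa using hz) a
  rw [zero_smul, sub_zero] at this
  exact this

theorem HasPPowerBasis.mul_smul' (h : HasPPowerBasis p M) (z w : ℤ_[p]) (a : M) :
    h.smul (z * w) a = h.smul z (h.smul w a) := by
  have h1 : ∀ m : ℤ, h.smul (m * w) a = m • h.smul w a := by
    intro m
    refine (h.eq_smul (l := padicApprox p w) (f := fun n => m * n) ?_ ?_).symm
    · push_cast
      exact (tendsto_intCast_padicApprox w).const_mul _
    · simp_rw [mul_smul]
      exact ((continuous_zsmul m).tendsto _).comp (h.tendsto_smul w a)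
  refine tendsto_nhds_unique (f := fun m : ℤ => h.smul ((m : ℤ_[p]) * w) a)
    (l := padicApprox p z) ?_ ?_
  · exact ((h.continuous_smul a).tendsto _).comp ((tendsto_intCast_padicApprox z).mul_const w)
  · simp_rw [h1]
    exact h.tendsto_smul z _

/-- The unique `ℤ_[p]`-module structure for which scalar multiplication is continuous in the
scalar. -/
noncomputable abbrev HasPPowerBasis.module (h : HasPPowerBasis p M) : Module ℤ_[p] M where
  smul := h.smul
  one_smul a := by
    change h.smul 1 a = a
    simpa using h.intCast_smul 1 a
  mul_smul := h.mul_smul'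
  smul_zero z := by
    change h.smul z 0 = 0
    simpa using h.smul_add' z 0 0
  smul_add := h.smul_add'
  add_smul := h.add_smul'
  zero_smul a := by
    change h.smul 0 a = 0
    simpa using h.intCast_smul 0 a

end PadicModule

section TfRank

variable (p : ℕ) [Fact p.Prime] (G : Type*) [Group G] [TopologicalSpace G] [IsTopologicalGroup G]
  [CompactSpace G] [T2Space G] [TotallyDisconnectedSpace G] [IsProP p G]

theorem TopologicalAbelianization.hasPPowerBasis :
    HasPPowerBasis p (Additive (TopologicalAbelianization G)) := by
  intro s hs
  obtain ⟨M, hMn, hMo, hMs⟩ := QuotientGroup.exists_open_subgroup_subset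
    (commutator G).topologicalClosure (s := Additive.ofMul ⁻¹' s) hs
  refine ⟨M.toAddSubgroup, hMo, hMs, ?_⟩
  have hq := IsProP.isPGroup_quotient (p := p) M hMo
  have : Finite (TopologicalAbelianization G ⧸ M) := M.quotient_finite_of_isOpen hMo
  obtain ⟨k, hk⟩ := IsPGroup.iff_card.mp hq
  refine ⟨k, fun x => ?_⟩
  change Additive.toMul x ^ p ^ k ∈ M
  rw [← QuotientGroup.eq_one_iff, QuotientGroup.mk_pow, ← hk]
  exact pow_card_eq_one'

noncomputable instance TopologicalAbelianization.padicModule :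
    Module ℤ_[p] (Additive (TopologicalAbelianization G)) :=
  (TopologicalAbelianization.hasPPowerBasis p G).module

open scoped TensorProduct in
/-- The torsion-free rank `dim_{ℚ_p} (ℚ_p ⊗_{ℤ_p} G^ab)` of the pro-`p` group `G`. -/
noncomputable def tfRank : ℕ :=
  Module.finrank ℚ_[p] (ℚ_[p] ⊗[ℤ_[p]] Additive (TopologicalAbelianization G))

/-- `G` is of global tf-rank: all open subgroups have the tf-rank of `G`. The common value `gtf(G)`
is then `tfRank p G`. -/
def IsOfGlobalTfRank : Prop :=
  ∀ U : OpenSubgroup G, tfRank p U.toSubgroup = tfRank p G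

end TfRank

/-! ### The transfer -/

section Transfer

variable {G : Type*} [Group G] [TopologicalSpace G] [IsTopologicalGroup G]

/-- The map `G^ab → H^ab` induced by a continuous homomorphism `G → H`. -/
def TopologicalAbelianization.map {H : Type*} [Group H] [TopologicalSpace H]
    [IsTopologicalGroup H] (f : G →* H) (hf : Continuous f) :
    TopologicalAbelianization G →* TopologicalAbelianization H :=
  QuotientGroup.map _ _ f <| by
    refine Subgroup.topologicalClosure_minimal _ ?_
      ((Subgroup.isClosed_topologicalClosure _).preimage hf)
    rw [← Subgroup.map_le_iff_le_comap, commutator_def, Subgroup.map_commutator]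
    exact (Subgroup.commutator_mono le_top le_top).trans (Subgroup.le_topologicalClosure _)

/-- For a normal subgroup `N` of `G`, the automorphism of `N^ab` induced by conjugation with
`g`. -/
def conjAb (N : Subgroup G) [N.Normal] (g : G) :
    TopologicalAbelianization N →* TopologicalAbelianization N :=
  TopologicalAbelianization.map (MulAut.conjNormal g : MulAut N).toMonoidHom <| by
    refine Continuous.subtype_mk (f := fun n : N => g * (n : G) * g⁻¹) ?_ _
    fun_prop

/-- The invariants `(N^ab)^{G/N}` of the conjugation action. As `N` acts trivially on `N^ab`, these
are the elements fixed by all of `G`. -/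
def abInvariants (N : Subgroup G) [N.Normal] : Subgroup (TopologicalAbelianization N) where
  carrier := {a | ∀ g : G, conjAb N g a = a}
  one_mem' g := map_one _
  mul_mem' ha hb g := by rw [map_mul, ha g, hb g]
  inv_mem' ha g := by rw [map_inv, ha g]

/-- The transfer `G → N^ab`, before passing to the quotient `G^ab` of `G`. -/
noncomputable def preTransfer (N : Subgroup G) [N.FiniteIndex] :
    G →* TopologicalAbelianization N :=
  MonoidHom.transfer (QuotientGroup.mk' (commutator N).topologicalClosure)

theorem section_inv_mul_mem (N : Subgroup G) {σ : G ⧸ N → G}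
    (hσ : ∀ q, QuotientGroup.mk (σ q) = q) (g : G) (q : G ⧸ N) :
    (σ q)⁻¹ * (g * σ (g⁻¹ • q)) ∈ N := by
  rw [← QuotientGroup.eq, hσ, ← smul_eq_mul, ← MulAction.Quotient.smul_coe, hσ, smul_inv_smul]

open Subgroup Subgroup.leftTransversals in
/-- The transfer as a product over an arbitrary system `σ` of coset representatives. -/
theorem preTransfer_apply (N : Subgroup G) [N.FiniteIndex] [Fintype (G ⧸ N)] {σ : G ⧸ N → G}
    (hσ : ∀ q, QuotientGroup.mk (σ q) = q) (g : G) :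
    preTransfer N g = ∏ q : G ⧸ N, (QuotientGroup.mk
      (⟨(σ q)⁻¹ * (g * σ (g⁻¹ • q)), section_inv_mul_mem N hσ g q⟩ : N) :
        TopologicalAbelianization N) := by
  let T : N.LeftTransversal := ⟨Set.range σ, isComplement_range_left hσ⟩
  have hT : ∀ q : G ⧸ N, (T.2.leftQuotientEquiv q : G) = σ q := fun q =>
    IsComplement.leftQuotientEquiv_apply hσ q
  rw [preTransfer, MonoidHom.transfer_def _ T]
  unfold diff
  refine Finset.prod_congr (by ext; simp) fun q _ => ?_
  rw [QuotientGroup.mk'_apply]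
  congr 1
  apply Subtype.ext
  change (T.2.leftQuotientEquiv q : G)⁻¹ * ((g • T).2.leftQuotientEquiv q : G) = _
  rw [smul_apply_eq_smul_apply_inv_smul, hT, hT, smul_eq_mul]

/-- The values of the transfer are invariant under conjugation. -/
theorem preTransfer_mem_abInvariants (N : Subgroup G) [N.Normal] [N.FiniteIndex] (g : G) :
    preTransfer N g ∈ abInvariants N := by
  intro h
  let _ := N.fintypeQuotientOfFiniteIndex
  have hσ : ∀ q : G ⧸ N, QuotientGroup.mk q.out = q := fun q => Quotient.out_eq' q
  have hτ : ∀ q : G ⧸ N, QuotientGroup.mk ((q * (h : G ⧸ N)).out * h⁻¹) = q := fun q => by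
    rw [QuotientGroup.mk_mul, hσ, QuotientGroup.mk_inv, mul_inv_cancel_right]
  rw [preTransfer_apply N hσ g, map_prod, ← preTransfer_apply N hσ g, preTransfer_apply N hτ g]
  refine (Fintype.prod_equiv (Equiv.mulRight (h : G ⧸ N)) _ _ fun q => ?_).symm
  change _ = QuotientGroup.mk (MulAut.conjNormal h _)
  congr 1
  apply Subtype.ext
  have hq : g⁻¹ • q * (h : G ⧸ N) = g⁻¹ • (q * (h : G ⧸ N)) := by
    induction q using QuotientGroup.induction_on with
    | H x =>
      rw [← QuotientGroup.mk_mul, MulAction.Quotient.smul_coe, MulAction.Quotient.smul_coe,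
        ← QuotientGroup.mk_mul, smul_eq_mul, smul_eq_mul, mul_assoc]
  simp [hq, mul_assoc]

theorem preTransfer_continuous (N : Subgroup G) [N.Normal] [N.FiniteIndex]
    (hN : IsOpen (N : Set G)) : Continuous (preTransfer N) := by
  refine continuous_of_continuousAt_one _ ?_
  let _ := N.fintypeQuotientOfFiniteIndex
  have hσ : ∀ q : G ⧸ N, QuotientGroup.mk q.out = q := fun q => Quotient.out_eq' q
  have hq : ∀ (g : N) (q : G ⧸ N), (g : G)⁻¹ • q = q := fun g q => by
    induction q using QuotientGroup.induction_on with
    | H x =>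
      rw [MulAction.Quotient.smul_coe, QuotientGroup.eq, smul_eq_mul]
      have := (inferInstance : N.Normal).conj_mem g g.2 x⁻¹
      simpa [mul_assoc] using this
  have h : Continuous (fun g : N => preTransfer N (g : G)) := by
    simp_rw [preTransfer_apply N hσ, hq]
    refine continuous_finsetProd _ fun q _ => QuotientGroup.continuous_mk.comp ?_
    exact Continuous.subtype_mk (by fun_prop) _
  exact (hN.isOpenEmbedding_subtypeVal.continuousAt_iff (x := (1 : N))).mp h.continuousAt

variable [CompactSpace G]

instance OpenNormalSubgroup.finiteIndex_toSubgroup (N : OpenNormalSubgroup G) :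
    N.toSubgroup.FiniteIndex := by
  have : Finite (G ⧸ N.toSubgroup) := N.toSubgroup.quotient_finite_of_isOpen N.isOpen
  exact Subgroup.finiteIndex_of_finite_quotient

/-- The transfer `i_{G,N} : G^ab → N^ab`. -/
noncomputable def abTransfer (N : OpenNormalSubgroup G) :
    TopologicalAbelianization G →* TopologicalAbelianization N.toSubgroup :=
  QuotientGroup.lift _ (preTransfer N.toSubgroup) <| by
    have hc : IsClosed
        ((commutator N.toSubgroup).topologicalClosure : Set N.toSubgroup) :=
      Subgroup.isClosed_topologicalClosure _
    refine Subgroup.topologicalClosure_minimal (t := (preTransfer N.toSubgroup).ker) _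
      (Abelianization.commutator_subset_ker _) ?_
    exact isClosed_singleton.preimage (preTransfer_continuous N.toSubgroup N.isOpen)

/-- The transfer with codomain restricted, `i°_{G,N} : G^ab → (N^ab)^{G/N}`. -/
noncomputable def abTransferInvariants (N : OpenNormalSubgroup G) :
    TopologicalAbelianization G →* abInvariants N.toSubgroup :=
  (abTransfer N).codRestrict _ fun x => by
    obtain ⟨g, rfl⟩ := QuotientGroup.mk_surjective x
    exact preTransfer_mem_abInvariants N.toSubgroup g

/-- The transfer kernel `tk(G/N) = ker i_{G,N}`. -/
noncomputable abbrev transferKernel (N : OpenNormalSubgroup G) :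
    Subgroup (TopologicalAbelianization G) :=
  (abTransfer N).ker

/-- The transfer cokernel `tc(G/N) = coker i°_{G,N}`. -/
abbrev TransferCokernel (N : OpenNormalSubgroup G) : Type _ :=
  abInvariants N.toSubgroup ⧸ (abTransferInvariants N).range

/-- The transfer ratio `ρ(G/N) = |tk(G/N)| / |tc(G/N)|`. -/
noncomputable def transferRatio (N : OpenNormalSubgroup G) : ℚ :=
  Nat.card (transferKernel N) / Nat.card (TransferCokernel N)

end Transfer

/-! ### Open `p`-sections -/

section Sections

/-- An open `p`-section of `G`: open subgroups `V ≤ U` with `|U : V| = p`. -/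
structure OpenPSection (p : ℕ) (G : Type*) [Group G] [TopologicalSpace G] where
  U : OpenSubgroup G
  V : OpenSubgroup G
  le : V ≤ U
  relIndex_eq : V.toSubgroup.relIndex U.toSubgroup = p

variable {p : ℕ} {G : Type*} [Group G] [TopologicalSpace G] [IsTopologicalGroup G]
  [CompactSpace G] [T2Space G] [TotallyDisconnectedSpace G]

/-- An open subgroup of index `p` in a pro-`p` group is normal. -/
theorem IsProP.normal_of_index_eq [Fact p.Prime] [IsProP p G] (N : Subgroup G)
    (hN : IsOpen (N : Set G)) (hi : N.index = p) : N.Normal := by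
  have : Finite (G ⧸ N) := N.quotient_finite_of_isOpen hN
  have : N.FiniteIndex := Subgroup.finiteIndex_of_finite_quotient
  have hC : IsOpen (N.normalCore : Set G) := Subgroup.isOpen_of_isClosed_of_finiteIndex _
    (N.normalCore_isClosed (N.isClosed_of_isOpen hN))
  have : Finite (G ⧸ N.normalCore) := N.normalCore.quotient_finite_of_isOpen hC
  obtain ⟨k, hk⟩ := IsPGroup.iff_card.mp (IsProP.isPGroup_quotient (p := p) N.normalCore hC)
  let π := QuotientGroup.mk' N.normalCore
  have hπ : (N.map π).comap π = N := by
    rw [Subgroup.comap_map_eq, QuotientGroup.ker_mk', sup_eq_left]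
    exact N.normalCore_le
  have hi' : (N.map π).index = p := by
    rw [← Subgroup.index_comap_of_surjective _ (QuotientGroup.mk'_surjective N.normalCore)]
    exact (congrArg Subgroup.index hπ).trans hi
  have hk0 : k ≠ 0 := by
    rintro rfl
    have h1 := (N.map π).index_dvd_card
    rw [hi', hk, pow_zero] at h1
    exact (Fact.out : p.Prime).one_lt.ne' (Nat.dvd_one.mp h1)
  have : (N.map π).Normal := Subgroup.normal_of_index_eq_minFac_card (by
    rw [hi', hk, (Fact.out : p.Prime).pow_minFac hk0])
  exact hπ ▸ this.comap π

/-- For an open `p`-section `(U, V)` of a pro-`p` group, `V` as an open normal subgroup of `U`. -/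
def OpenPSection.normalSubgroup [Fact p.Prime] [IsProP p G] (S : OpenPSection p G) :
    OpenNormalSubgroup S.U.toSubgroup where
  toSubgroup := S.V.toSubgroup.subgroupOf S.U.toSubgroup
  isOpen' := Subgroup.subgroupOf_isOpen _ _ S.V.isOpen
  isNormal' := IsProP.normal_of_index_eq (p := p) _
    (Subgroup.subgroupOf_isOpen _ _ S.V.isOpen) S.relIndex_eq

end Sections

/-! ### Kernels and cokernels of composites -/

section KerCoker

variable {A B C : Type*} [CommGroup A] [CommGroup B] [CommGroup C]

@[to_additive]
theorem MonoidHom.card_ker_comp (f : A →* B) (g : B →* C) :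
    Nat.card (g.comp f).ker = Nat.card f.ker * Nat.card (g.ker ⊓ f.range : Subgroup B) := by
  have h : f.ker ≤ (g.comp f).ker := fun x hx => by
    rw [MonoidHom.mem_ker] at hx ⊢
    rw [MonoidHom.comp_apply, hx, map_one]
  have h1 := Subgroup.relIndex_mul_relIndex (⊥ : Subgroup A) _ _ bot_le h
  rw [Subgroup.relIndex_bot_left, Subgroup.relIndex_bot_left, Subgroup.relIndex_ker] at h1
  rw [← h1]
  congr 3
  rw [← MonoidHom.comap_ker, Subgroup.map_comap_eq, inf_comm]

@[to_additive]
theorem MonoidHom.index_range_comp (f : A →* B) (g : B →* C) :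
    (g.comp f).range.index = (f.range ⊔ g.ker).index * g.range.index := by
  rw [MonoidHom.range_comp, Subgroup.index_map]

@[to_additive AddSubgroup.card_inf_mul_relIndex]
theorem Subgroup.card_inf_mul_relIndex (H K : Subgroup A) :
    Nat.card (H ⊓ K : Subgroup A) * K.relIndex H = Nat.card H := by
  have h := Subgroup.relIndex_mul_relIndex (⊥ : Subgroup A) (H ⊓ K) H bot_le inf_le_left
  rwa [Subgroup.relIndex_bot_left, Subgroup.relIndex_bot_left, Subgroup.inf_relIndex_left] at h

@[to_additive AddSubgroup.relIndex_mul_index_sup]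
theorem Subgroup.relIndex_mul_index_sup (H K : Subgroup A) :
    H.relIndex K * (H ⊔ K).index = H.index := by
  rw [← Subgroup.relIndex_sup_left, Subgroup.relIndex_mul_index le_sup_left]

/-- Multiplicativity of the Euler characteristic `|ker f| / |coker f|`. -/
@[to_additive AddMonoidHom.card_ker_comp_mul_index]
theorem MonoidHom.card_ker_comp_mul_index (f : A →* B) (g : B →* C) :
    Nat.card (g.comp f).ker * (f.range.index * g.range.index) =
      Nat.card f.ker * Nat.card g.ker * (g.comp f).range.index := by
  rw [MonoidHom.card_ker_comp, MonoidHom.index_range_comp,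
    ← Subgroup.relIndex_mul_index_sup f.range g.ker,
    ← Subgroup.card_inf_mul_relIndex g.ker f.range]
  ring

theorem MonoidHom.index_range_ne_zero_of_comp {f : A →* B} {g : B →* C}
    (h : (g.comp f).range.index ≠ 0) : g.range.index ≠ 0 := by
  rw [MonoidHom.index_range_comp] at h
  exact right_ne_zero_of_mul h

theorem MonoidHom.card_ker_ne_zero_of_comp {f : A →* B} {g : B →* C}
    (h : Nat.card (g.comp f).ker ≠ 0) (hf : f.range.index ≠ 0) : Nat.card g.ker ≠ 0 := by
  rw [MonoidHom.card_ker_comp] at h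
  rw [← Subgroup.relIndex_mul_index_sup f.range g.ker] at hf
  rw [← Subgroup.card_inf_mul_relIndex g.ker f.range]
  exact mul_ne_zero (right_ne_zero_of_mul h) (left_ne_zero_of_mul hf)

@[to_additive]
theorem MonoidHom.card_ker_comp_ne_zero {f : A →* B} {g : B →* C}
    (hf : Nat.card f.ker ≠ 0) (hg : Nat.card g.ker ≠ 0) : Nat.card (g.comp f).ker ≠ 0 := by
  rw [MonoidHom.card_ker_comp]
  rw [← Subgroup.card_inf_mul_relIndex g.ker f.range] at hg
  exact mul_ne_zero hf (left_ne_zero_of_mul hg)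

@[to_additive]
theorem MonoidHom.index_range_comp_ne_zero {f : A →* B} {g : B →* C}
    (hf : f.range.index ≠ 0) (hg : g.range.index ≠ 0) : (g.comp f).range.index ≠ 0 := by
  rw [MonoidHom.index_range_comp]
  rw [← Subgroup.relIndex_mul_index_sup f.range g.ker] at hf
  exact mul_ne_zero (right_ne_zero_of_mul hf) hg

/-- Endomorphisms that correspond under a homomorphism with finite kernel and cokernel have the
same Euler characteristic. -/
@[to_additive AddMonoidHom.card_ker_mul_index_of_semiconj]
theorem MonoidHom.card_ker_mul_index_of_semiconj {φ : A →* B} {α : A →* A} {β : B →* B}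
    (h : φ.comp α = β.comp φ) (hk : Nat.card φ.ker ≠ 0) (hc : φ.range.index ≠ 0)
    (hβk : Nat.card β.ker ≠ 0) (hβc : β.range.index ≠ 0) :
    Nat.card α.ker * β.range.index = Nat.card β.ker * α.range.index := by
  have h1 := MonoidHom.card_ker_comp_mul_index φ β
  have h2 := MonoidHom.card_ker_comp_mul_index α φ
  rw [h] at h2
  have hx := MonoidHom.card_ker_comp_ne_zero hk hβk
  have hy := MonoidHom.index_range_comp_ne_zero hc hβc
  refine Nat.eq_of_mul_eq_mul_left (Nat.pos_of_ne_zero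
    (mul_ne_zero (mul_ne_zero hk hc) (mul_ne_zero hx hy))) ?_
  calc _ = (Nat.card (β.comp φ).ker * (φ.range.index * β.range.index)) *
        (Nat.card α.ker * Nat.card φ.ker * (β.comp φ).range.index) := by ring
    _ = _ := by rw [h1, ← h2]; ring

end KerCoker

/-! ### Finitely generated `ℤ_[p]`-modules -/

section PadicFG

variable (p : ℕ) [Fact p.Prime]

theorem PadicInt.finite_quotient {I : Ideal ℤ_[p]} (hI : I ≠ ⊥) : Finite (ℤ_[p] ⧸ I) := by
  obtain ⟨n, rfl⟩ := PadicInt.ideal_eq_span_pow_p hI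
  rw [← PadicInt.ker_toZModPow]
  have : NeZero (p ^ n) := ⟨pow_ne_zero _ (Fact.out : p.Prime).ne_zero⟩
  exact Finite.of_injective _ (RingHom.kerLift_injective (PadicInt.toZModPow (p := p) n))

variable {M : Type*} [AddCommGroup M] [Module ℤ_[p] M] [Module.Finite ℤ_[p] M]

theorem PadicInt.finite_of_isTorsion (hM : Module.IsTorsion ℤ_[p] M) : Finite M := by
  classical
  obtain ⟨ι, _, q, hq, e, ⟨f⟩⟩ := Module.equiv_directSum_of_isTorsion hM
  have : ∀ i, Finite (ℤ_[p] ⧸ Submodule.span ℤ_[p] {q i ^ e i}) := fun i =>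
    PadicInt.finite_quotient p (I := Ideal.span {q i ^ e i}) (by
      rw [Ne, Ideal.span_singleton_eq_bot]
      exact pow_ne_zero _ (hq i).ne_zero)
  exact Finite.of_equiv _ (f.toEquiv.trans DFinsupp.equivFunOnFintype).symm

theorem PadicInt.index_range_nsmul_pi (n : ℕ) :
    (nsmulAddMonoidHom (α := Fin n → ℤ_[p]) p).range.index = p ^ n := by
  have h1 : (nsmulAddMonoidHom (α := ℤ_[p]) p).range.index = p := by
    have : (nsmulAddMonoidHom (α := ℤ_[p]) p).range =
        (PadicInt.toZMod (p := p)).toAddMonoidHom.ker := by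
      ext x
      have h : x ∈ RingHom.ker (PadicInt.toZMod (p := p)) ↔ ∃ y, p • y = x := by
        rw [PadicInt.ker_toZMod, PadicInt.maximalIdeal_eq_span_p, Ideal.mem_span_singleton]
        simp only [dvd_iff_exists_eq_mul_right, nsmul_eq_mul, eq_comm]
      rw [RingHom.mem_ker] at h
      rw [AddMonoidHom.mem_ker, AddMonoidHom.mem_range]
      exact h.symm
    rw [this, AddSubgroup.index_ker, AddMonoidHom.range_eq_top.mpr, AddSubgroup.card_top,
      Nat.card_zmod]
    exact ZMod.ringHom_surjective (PadicInt.toZMod (p := p))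
  have h2 : (nsmulAddMonoidHom (α := Fin n → ℤ_[p]) p).range =
      AddSubgroup.pi Set.univ fun _ => (nsmulAddMonoidHom (α := ℤ_[p]) p).range := by
    ext x
    simp only [AddMonoidHom.mem_range, AddSubgroup.mem_pi, Set.mem_univ, true_imp_iff]
    constructor
    · rintro ⟨y, rfl⟩ i
      exact ⟨y i, rfl⟩
    · intro h
      choose y hy using h
      exact ⟨y, funext hy⟩
  rw [h2, AddSubgroup.index_pi]
  simp [h1]

/-- Multiplication by `p` on a finitely generated `ℤ_[p]`-module of rank `r` has Euler
characteristic `p⁻ʳ`. -/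
theorem PadicInt.card_ker_nsmul_mul_pow_finrank :
    Nat.card (nsmulAddMonoidHom (α := M) p).ker ≠ 0 ∧
    Nat.card (nsmulAddMonoidHom (α := M) p).ker * p ^ Module.finrank ℤ_[p] M =
      (nsmulAddMonoidHom (α := M) p).range.index := by
  let T := Submodule.torsion ℤ_[p] M
  have hp : (p : ℤ_[p]) ≠ 0 := Nat.cast_ne_zero.mpr (Fact.out : p.Prime).ne_zero
  have hT : Finite T := PadicInt.finite_of_isTorsion p (Submodule.torsion_isTorsion)
  have hpT : (nsmulAddMonoidHom (α := M) p).ker ≤ T.toAddSubgroup := fun x hx => by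
    refine (Submodule.mem_torsion_iff x).mpr ⟨⟨p, mem_nonZeroDivisors_of_ne_zero hp⟩, ?_⟩
    have : p • x = 0 := hx
    rw [Submonoid.mk_smul, Nat.cast_smul_eq_nsmul, this]
  have hk : Nat.card (nsmulAddMonoidHom (α := M) p).ker ≠ 0 := by
    have : Finite T.toAddSubgroup := hT
    have := Finite.of_injective _ (AddSubgroup.inclusion_injective hpT)
    exact Nat.card_pos.ne'
  refine ⟨hk, ?_⟩
  let e : (M ⧸ T) ≃ₗ[ℤ_[p]] (Fin (Module.finrank ℤ_[p] M) → ℤ_[p]) :=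
    LinearEquiv.ofFinrankEq _ _ (by
      rw [Module.finrank_fin_fun]
      exact finrank_quotient_eq_of_le_torsion le_rfl)
  let φ : M →+ (Fin (Module.finrank ℤ_[p] M) → ℤ_[p]) := (e.toLinearMap ∘ₗ T.mkQ).toAddMonoidHom
  have hφs : Function.Surjective φ := e.surjective.comp T.mkQ_surjective
  have hφr : φ.range.index = 1 := by
    rw [AddMonoidHom.range_eq_top.mpr hφs, AddSubgroup.index_top]
  have hφk : Nat.card φ.ker ≠ 0 := by
    have : φ.ker = T.toAddSubgroup := by
      ext x
      change e (T.mkQ x) = 0 ↔ x ∈ T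
      rw [LinearEquiv.map_eq_zero_iff, Submodule.mkQ_apply, Submodule.Quotient.mk_eq_zero]
    rw [this]
    have : Finite T.toAddSubgroup := hT
    exact Nat.card_pos.ne'
  have hβk : Nat.card (nsmulAddMonoidHom
      (α := Fin (Module.finrank ℤ_[p] M) → ℤ_[p]) p).ker = 1 := by
    rw [AddSubgroup.card_eq_one, AddMonoidHom.ker_eq_bot_iff]
    intro x y hxy
    have hxy : p • x = p • y := hxy
    rw [← Nat.cast_smul_eq_nsmul ℤ_[p], ← Nat.cast_smul_eq_nsmul ℤ_[p]] at hxy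
    exact smul_right_injective _ hp hxy
  have h := AddMonoidHom.card_ker_mul_index_of_semiconj (φ := φ)
    (α := nsmulAddMonoidHom (α := M) p)
    (β := nsmulAddMonoidHom (α := Fin (Module.finrank ℤ_[p] M) → ℤ_[p]) p)
    (by ext x : 1; exact map_nsmul φ p x) hφk (by rw [hφr]; exact one_ne_zero)
    (by rw [hβk]; exact one_ne_zero)
    (by rw [PadicInt.index_range_nsmul_pi]; exact pow_ne_zero _ (Fact.out : p.Prime).ne_zero)
  rwa [PadicInt.index_range_nsmul_pi, hβk, one_mul] at h

/-- A linear map of finitely generated `ℤ_[p]`-modules of equal rank with finite cokernel has finite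
kernel. -/
theorem PadicInt.finite_ker_of_finrank_eq {L : Type*} [AddCommGroup L] [Module ℤ_[p] L]
    [Module.Finite ℤ_[p] L] (f : M →ₗ[ℤ_[p]] L)
    (h : Module.finrank ℤ_[p] M = Module.finrank ℤ_[p] L)
    (hf : ∀ x, p • x ∈ LinearMap.range f) : Finite (LinearMap.ker f) := by
  have hp : (p : ℤ_[p]) ≠ 0 := Nat.cast_ne_zero.mpr (Fact.out : p.Prime).ne_zero
  apply PadicInt.finite_of_isTorsion p
  rw [← Module.finrank_eq_zero_iff_isTorsion]
  have h1 := (LinearMap.range f).finrank_quotient_add_finrank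
  have h2 := (LinearMap.ker f).finrank_quotient_add_finrank
  have h3 : Module.finrank ℤ_[p] (L ⧸ LinearMap.range f) = 0 := by
    rw [Module.finrank_eq_zero_iff_isTorsion]
    intro x
    obtain ⟨y, rfl⟩ := Submodule.Quotient.mk_surjective _ x
    refine ⟨⟨p, mem_nonZeroDivisors_of_ne_zero hp⟩, ?_⟩
    rw [Submonoid.mk_smul, ← Submodule.Quotient.mk_smul, Nat.cast_smul_eq_nsmul,
      Submodule.Quotient.mk_eq_zero]
    exact hf y
  have h4 := f.quotKerEquivRange.finrank_eq
  omega

end PadicFG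

/-! ### Topological finite generation -/

section TopFG

variable {G : Type*} [Group G] [TopologicalSpace G]

theorem TopologicallyFG.openSubgroup [IsTopologicalGroup G] [CompactSpace G]
    (hG : TopologicallyFG G) (U : OpenSubgroup G) :
    TopologicallyFG U.toSubgroup := by
  obtain ⟨S, hS, hd⟩ := hG
  let D := Subgroup.closure S
  have : Finite S := hS
  have hDfg : Group.FG D := Group.closure_finite_fg S
  have : Finite (G ⧸ U.toSubgroup) := U.toSubgroup.quotient_finite_of_isOpen U.isOpen
  have : U.toSubgroup.FiniteIndex := Subgroup.finiteIndex_of_finite_quotient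
  have hfg : Group.FG (U.toSubgroup.subgroupOf D) := inferInstance
  let f : U.toSubgroup.subgroupOf D →* U.toSubgroup :=
    (D.subtype.comp (U.toSubgroup.subgroupOf D).subtype).codRestrict _ fun x => x.2
  obtain ⟨T, hT, hTf⟩ := Group.fg_iff.mp hfg
  refine ⟨f '' T, hTf.image f, ?_⟩
  rw [← MonoidHom.map_closure, hT]
  intro u
  rw [closure_subtype]
  refine closure_mono ?_ (hd.open_subset_closure_inter U.isOpen u.2)
  rintro x ⟨hxU, hxD⟩
  exact ⟨⟨x, hxU⟩, ⟨⟨⟨x, hxD⟩, hxU⟩, Subgroup.mem_top _, rfl⟩, rfl⟩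

end TopFG

/-! ### The abelianization as a `ℤ_[p]`-module -/

section AbModule

variable (p : ℕ) [Fact p.Prime] {G : Type*} [Group G] [TopologicalSpace G] [IsTopologicalGroup G]
  [CompactSpace G] [T2Space G] [TotallyDisconnectedSpace G] [IsProP p G]
  {H : Type*} [Group H] [TopologicalSpace H] [IsTopologicalGroup H]
  [CompactSpace H] [T2Space H] [TotallyDisconnectedSpace H] [IsProP p H]

theorem tfRank_eq_finrank :
    tfRank p G = Module.finrank ℤ_[p] (Additive (TopologicalAbelianization G)) :=
  (TensorProduct.isBaseChange ℤ_[p] (Additive (TopologicalAbelianization G)) ℚ_[p]).finrank_eq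

theorem TopologicalAbelianization.module_finite (hG : TopologicallyFG G) :
    Module.Finite ℤ_[p] (Additive (TopologicalAbelianization G)) := by
  obtain ⟨S, hS, hd⟩ := hG
  have := hS.fintype
  let a : S → Additive (TopologicalAbelianization G) := fun s =>
    Additive.ofMul (QuotientGroup.mk (s : G))
  let φ := Fintype.linearCombination ℤ_[p] a
  have hφ : Continuous φ := by
    have : ∀ z, φ z = ∑ s, z s • a s := fun z => Fintype.linearCombination_apply ℤ_[p] a z
    simp_rw [funext this]
    refine continuous_finsetSum _ fun s _ => ?_
    exact ((TopologicalAbelianization.hasPPowerBasis p G).continuous_smul (a s)).comp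
      (continuous_apply s)
  have hc : IsClosed (Set.range φ) := (isCompact_range hφ).isClosed
  let W : Subgroup G := (AddSubgroup.toSubgroup' (LinearMap.range φ).toAddSubgroup).comap
    (QuotientGroup.mk' (commutator G).topologicalClosure)
  have hW : IsClosed (W : Set G) := hc.preimage QuotientGroup.continuous_mk
  have hSW : Subgroup.closure S ≤ W := by
    rw [Subgroup.closure_le]
    intro s hs
    classical
    exact ⟨Pi.single ⟨s, hs⟩ 1,
      (Fintype.linearCombination_apply_single ℤ_[p] a ⟨s, hs⟩ 1).trans (one_smul _ _)⟩
  have hφs : Function.Surjective φ := by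
    intro x
    obtain ⟨g, hg⟩ := QuotientGroup.mk_surjective (Additive.toMul x)
    have : g ∈ W := hW.closure_subset_iff.mpr hSW (hd g)
    obtain ⟨z, hz⟩ := this
    exact ⟨z, hz.trans hg⟩
  exact Module.Finite.of_surjective φ hφs

theorem TopologicalAbelianization.continuous_map (f : G →* H) (hf : Continuous f) :
    Continuous (TopologicalAbelianization.map f hf) :=
  (QuotientGroup.continuous_mk.comp hf).quotient_lift _

/-- The map of abelianizations induced by a continuous homomorphism is `ℤ_[p]`-linear. -/
noncomputable def TopologicalAbelianization.linearMap (f : G →* H) (hf : Continuous f) :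
    Additive (TopologicalAbelianization G) →ₗ[ℤ_[p]] Additive (TopologicalAbelianization H) where
  __ := MonoidHom.toAdditive (TopologicalAbelianization.map f hf)
  map_smul' z a := by
    have hG := TopologicalAbelianization.hasPPowerBasis p G
    have hH := TopologicalAbelianization.hasPPowerBasis p H
    refine hH.eq_smul (l := padicApprox p z) (f := id) (tendsto_intCast_padicApprox z) ?_
    have h := ((TopologicalAbelianization.continuous_map f hf).tendsto _).comp
      (hG.tendsto_smul z a)
    refine h.congr fun m => ?_
    exact map_zsmul (MonoidHom.toAdditive (TopologicalAbelianization.map f hf)) m a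

theorem tfRank_congr (e : G ≃* H) (he : Continuous e) (he' : Continuous e.symm) :
    tfRank p G = tfRank p H := by
  rw [tfRank_eq_finrank, tfRank_eq_finrank]
  refine (LinearEquiv.ofLinearMap (TopologicalAbelianization.linearMap p e.toMonoidHom he)
    (TopologicalAbelianization.linearMap p e.symm.toMonoidHom he') ?_ ?_).finrank_eq
  · ext x
    obtain ⟨g, hg⟩ := QuotientGroup.mk_surjective (Additive.toMul x)
    obtain rfl : Additive.ofMul (QuotientGroup.mk g) = x := hg
    exact congrArg (fun y => Additive.ofMul (QuotientGroup.mk y)) (e.apply_symm_apply g)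
  · ext x
    obtain ⟨g, hg⟩ := QuotientGroup.mk_surjective (Additive.toMul x)
    obtain rfl : Additive.ofMul (QuotientGroup.mk g) = x := hg
    exact congrArg (fun y => Additive.ofMul (QuotientGroup.mk y)) (e.symm_apply_apply g)

end AbModule

/-! ### Conjugation and transfer for a cyclic quotient -/

section CyclicQuotient

variable {G : Type*} [Group G] [TopologicalSpace G] [IsTopologicalGroup G]

section Conj

variable (N : Subgroup G) [N.Normal]

theorem conjAb_mul (x y : G) (b : TopologicalAbelianization N) :
    conjAb N (x * y) b = conjAb N x (conjAb N y b) := by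
  obtain ⟨n, rfl⟩ := QuotientGroup.mk_surjective b
  change QuotientGroup.mk (MulAut.conjNormal (x * y) n) =
    QuotientGroup.mk (MulAut.conjNormal x (MulAut.conjNormal y n))
  rw [map_mul, MulAut.mul_apply]

theorem conjAb_of_mem {x : G} (hx : x ∈ N) (b : TopologicalAbelianization N) :
    conjAb N x b = b := by
  obtain ⟨n, rfl⟩ := QuotientGroup.mk_surjective b
  have h : (MulAut.conjNormal x : MulAut N) n = ⟨x, hx⟩ * n * ⟨x, hx⟩⁻¹ := Subtype.ext rfl
  change QuotientGroup.mk (MulAut.conjNormal x n) = _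
  rw [h, QuotientGroup.mk_mul, QuotientGroup.mk_mul, QuotientGroup.mk_inv,
    mul_comm (QuotientGroup.mk _) (QuotientGroup.mk n), mul_inv_cancel_right]

theorem conjAb_inv_apply (x : G) (b : TopologicalAbelianization N) :
    conjAb N x⁻¹ (conjAb N x b) = b := by
  rw [← conjAb_mul, inv_mul_cancel, conjAb_of_mem N N.one_mem]

theorem continuous_conjAb (x : G) : Continuous (conjAb N x) := by
  have h : Continuous (MulAut.conjNormal x : MulAut N).toMonoidHom :=
    Continuous.subtype_mk (f := fun n : N => x * (n : G) * x⁻¹) (by fun_prop) _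
  exact (QuotientGroup.continuous_mk.comp h).quotient_lift _

/-- The endomorphism `g - 1` of `N^ab`. -/
def conjAbSubOne (g : G) : TopologicalAbelianization N →* TopologicalAbelianization N :=
  conjAb N g / MonoidHom.id _

theorem conjAbSubOne_apply (g : G) (b : TopologicalAbelianization N) :
    conjAbSubOne N g b = conjAb N g b / b := rfl

theorem eq_top_of_zpowers_eq_top {N H : Subgroup G} [N.Normal] {g : G}
    (hg : Subgroup.zpowers (g : G ⧸ N) = ⊤) (hN : N ≤ H) (hgH : g ∈ H) : H = ⊤ := by
  rw [Subgroup.eq_top_iff']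
  intro x
  obtain ⟨k, hk⟩ : (x : G ⧸ N) ∈ Subgroup.zpowers (g : G ⧸ N) := hg ▸ Subgroup.mem_top _
  have hk : ((g ^ k : G) : G ⧸ N) = x := hk
  rw [QuotientGroup.eq] at hk
  simpa using H.mul_mem (H.zpow_mem hgH k) (hN hk)

variable {N} {g : G} (hg : Subgroup.zpowers (g : G ⧸ N) = ⊤)

include hg

theorem ker_conjAbSubOne : (conjAbSubOne N g).ker = abInvariants N := by
  ext b
  rw [MonoidHom.mem_ker, conjAbSubOne_apply, div_eq_one]
  refine ⟨fun hb => ?_, fun hb => hb g⟩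
  let H : Subgroup G :=
    { carrier := {x | conjAb N x b = b}
      one_mem' := conjAb_of_mem N N.one_mem b
      mul_mem' := fun {x y} hx hy => by
        change conjAb N (x * y) b = b
        rw [conjAb_mul, hy, hx]
      inv_mem' := fun {x} hx => by
        have h := conjAb_inv_apply N x b
        rwa [hx] at h }
  have hH : H = ⊤ := eq_top_of_zpowers_eq_top hg (fun x hx => conjAb_of_mem N hx b) hb
  exact fun x => (hH ▸ Subgroup.mem_top x : x ∈ H)

theorem conjAb_div_mem_range_conjAbSubOne (x : G) (b : TopologicalAbelianization N) :
    conjAb N x b / b ∈ (conjAbSubOne N g).range := by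
  let H : Subgroup G :=
    { carrier := {x | ∀ b, conjAb N x b / b ∈ (conjAbSubOne N g).range}
      one_mem' := fun b => by
        rw [conjAb_of_mem N N.one_mem b, div_self']
        exact one_mem _
      mul_mem' := fun {x y} hx hy b => by
        rw [conjAb_mul, ← div_mul_div_cancel _ (conjAb N y b)]
        exact mul_mem (hx _) (hy _)
      inv_mem' := fun {x} hx b => by
        have h := inv_mem (hx (conjAb N x⁻¹ b))
        rw [← conjAb_mul, mul_inv_cancel, conjAb_of_mem N N.one_mem, inv_div] at h
        exact h }
  have hH : H = ⊤ := eq_top_of_zpowers_eq_top hg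
    (fun x hx b => by rw [conjAb_of_mem N hx, div_self']; exact one_mem _) (fun b => ⟨b, rfl⟩)
  exact (hH ▸ Subgroup.mem_top x : x ∈ H) b

/-- For a cyclic quotient `G/N` generated by `g`, the kernel of `N^ab → G^ab` is the image of
`g - 1`. -/
theorem ker_map_subtype_eq_range [CompactSpace G] [T2Space G] (hN : IsClosed (N : Set G)) :
    (TopologicalAbelianization.map N.subtype continuous_subtype_val).ker =
      (conjAbSubOne N g).range := by
  apply le_antisymm
  · have : CompactSpace N := isCompact_iff_compactSpace.mp hN.isCompact
    have : IsClosed ((commutator N).topologicalClosure : Set N) :=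
      Subgroup.isClosed_topologicalClosure _
    have hcont : Continuous (conjAbSubOne N g) := (continuous_conjAb N g).div' continuous_id
    have hcl : IsClosed ((conjAbSubOne N g).range : Set (TopologicalAbelianization N)) :=
      (isCompact_range hcont).isClosed
    let W : Subgroup G := ((conjAbSubOne N g).range.comap
      (QuotientGroup.mk' (commutator N).topologicalClosure)).map N.subtype
    have hW : IsClosed (W : Set G) :=
      hN.isClosedEmbedding_subtypeVal.isClosedMap _ (hcl.preimage QuotientGroup.continuous_mk)
    have hconj : ∀ (x : G) (n : N), (MulAut.conjNormal x n * n⁻¹ : N).1 ∈ W := fun x n => by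
      refine ⟨MulAut.conjNormal x n * n⁻¹, ?_, rfl⟩
      have h := conjAb_div_mem_range_conjAbSubOne hg x (QuotientGroup.mk n)
      rw [div_eq_mul_inv] at h
      exact h
    have hWn : W.Normal := ⟨fun w hw x => by
      obtain ⟨n, hn, rfl⟩ := id hw
      have h := W.mul_mem (hconj x n) hw
      simpa using h⟩
    have hWN : W ≤ N := by
      rintro _ ⟨n, -, rfl⟩
      exact n.2
    have hcyc : IsCyclic (G ⧸ N) := ⟨(g : G ⧸ N), (Subgroup.eq_top_iff' _).mp hg⟩
    let f : G ⧸ W →* G ⧸ N := QuotientGroup.map W N (MonoidHom.id G) hWN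
    have hf : f.ker ≤ Subgroup.center (G ⧸ W) := by
      intro y hy
      obtain ⟨n, rfl⟩ := QuotientGroup.mk_surjective y
      have hn : n ∈ N := (QuotientGroup.eq_one_iff n).mp hy
      rw [Subgroup.mem_center_iff]
      intro z
      obtain ⟨x, rfl⟩ := QuotientGroup.mk_surjective z
      have h := (QuotientGroup.eq_one_iff _).mpr (hconj x ⟨n, hn⟩)
      have h' : ((x * n * x⁻¹ * n⁻¹ : G) : G ⧸ W) = 1 := h
      simp only [QuotientGroup.mk_mul, QuotientGroup.mk_inv] at h'
      rwa [mul_inv_eq_one, mul_inv_eq_iff_eq_mul] at h'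
    have hcomm := f.isMulCommutative_of_isCyclic_of_ker_le_center hf
    have hle : (commutator G).topologicalClosure ≤ W :=
      Subgroup.topologicalClosure_minimal _
        (Subgroup.Normal.quotient_commutative_iff_commutator_le.mp hcomm) hW
    intro b hb
    obtain ⟨n, rfl⟩ := QuotientGroup.mk_surjective b
    have hn : (n : G) ∈ (commutator G).topologicalClosure := (QuotientGroup.eq_one_iff _).mp hb
    obtain ⟨m, hm, hmn⟩ := hle hn
    obtain rfl : m = n := Subtype.ext hmn
    exact hm
  · rintro _ ⟨b, rfl⟩
    obtain ⟨n, rfl⟩ := QuotientGroup.mk_surjective b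
    rw [MonoidHom.mem_ker, conjAbSubOne_apply, map_div, div_eq_one]
    change ((g * n * g⁻¹ : G) : TopologicalAbelianization G) = ((n : G) : _)
    rw [QuotientGroup.mk_mul, QuotientGroup.mk_mul, QuotientGroup.mk_inv,
      mul_comm (g : TopologicalAbelianization G), mul_inv_cancel_right]

theorem card_ker_map_subtype [CompactSpace G] [T2Space G] (hN : IsClosed (N : Set G)) :
    Nat.card (TopologicalAbelianization.map N.subtype continuous_subtype_val).ker =
      (abInvariants N).index := by
  rw [ker_map_subtype_eq_range hg hN, ← Subgroup.index_ker, ker_conjAbSubOne hg]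

theorem index_range_map_subtype (hN : IsClosed (N : Set G)) :
    (TopologicalAbelianization.map N.subtype continuous_subtype_val).range.index = N.index := by
  have hcyc : IsCyclic (G ⧸ N) := ⟨(g : G ⧸ N), (Subgroup.eq_top_iff' _).mp hg⟩
  have hle : (commutator G).topologicalClosure ≤ N :=
    Subgroup.topologicalClosure_minimal _
      (Subgroup.Normal.quotient_commutative_iff_commutator_le.mp inferInstance) hN
  have h : (TopologicalAbelianization.map N.subtype continuous_subtype_val).range =
      N.map (QuotientGroup.mk' (commutator G).topologicalClosure) := by
    ext x
    constructor
    · rintro ⟨b, rfl⟩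
      obtain ⟨n, rfl⟩ := QuotientGroup.mk_surjective b
      exact ⟨n, n.2, rfl⟩
    · rintro ⟨n, hn, rfl⟩
      exact ⟨QuotientGroup.mk ⟨n, hn⟩, rfl⟩
  rw [h, Subgroup.index_map_eq _ (QuotientGroup.mk'_surjective _)]
  rwa [QuotientGroup.ker_mk']

end Conj

theorem preTransfer_of_mem_of_invariant (N : Subgroup G) [N.Normal] [N.FiniteIndex] (n : N)
    (hn : (QuotientGroup.mk n : TopologicalAbelianization N) ∈ abInvariants N) :
    preTransfer N n = (QuotientGroup.mk n) ^ N.index := by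
  let _ := N.fintypeQuotientOfFiniteIndex
  have hσ : ∀ q : G ⧸ N, QuotientGroup.mk q.out = q := fun q => Quotient.out_eq' q
  have hq : ∀ q : G ⧸ N, (n : G)⁻¹ • q = q := fun q => by
    induction q using QuotientGroup.induction_on with
    | H x =>
      rw [MulAction.Quotient.smul_coe, QuotientGroup.eq, smul_eq_mul]
      have := (inferInstance : N.Normal).conj_mem n n.2 x⁻¹
      simpa [mul_assoc] using this
  rw [preTransfer_apply N hσ, Subgroup.index_eq_card, Nat.card_eq_fintype_card,
    ← Finset.card_univ, ← Finset.prod_const]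
  refine Finset.prod_congr rfl fun q _ => ?_
  refine Eq.trans ?_ (hn q.out⁻¹)
  change _ = QuotientGroup.mk (MulAut.conjNormal q.out⁻¹ n)
  congr 1
  apply Subtype.ext
  simp [hq, mul_assoc]

theorem abTransferInvariants_map_subtype [CompactSpace G] (N : OpenNormalSubgroup G)
    (b : abInvariants N.toSubgroup) :
    abTransferInvariants N
      (TopologicalAbelianization.map N.toSubgroup.subtype continuous_subtype_val b) =
        b ^ N.toSubgroup.index := by
  obtain ⟨b, hb⟩ := b
  obtain ⟨n, rfl⟩ := QuotientGroup.mk_surjective b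
  exact Subtype.ext (preTransfer_of_mem_of_invariant N.toSubgroup n hb)

end CyclicQuotient

/-! ### The transfer ratio -/

section Ratio

variable {p : ℕ} [Fact p.Prime] {G : Type*} [Group G] [TopologicalSpace G] [IsTopologicalGroup G]
  [CompactSpace G] [T2Space G] [TotallyDisconnectedSpace G] [IsProP p G]

/-- For an open subgroup `N` of index `p` with the same tf-rank `r` as `G`, the transfer has finite
kernel and cokernel, and Euler characteristic `p¹⁻ʳ`. -/
theorem card_transferKernel_mul_pow (hfg : TopologicallyFG G) (N : OpenNormalSubgroup G)
    (hi : N.toSubgroup.index = p) (hr : tfRank p N.toSubgroup = tfRank p G) :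
    Nat.card (transferKernel N) ≠ 0 ∧ Nat.card (TransferCokernel N) ≠ 0 ∧
      Nat.card (transferKernel N) * p ^ tfRank p G = p * Nat.card (TransferCokernel N) := by
  have hp0 : p ≠ 0 := (Fact.out : p.Prime).ne_zero
  have hNcl : IsClosed (N.toSubgroup : Set G) := N.toSubgroup.isClosed_of_isOpen N.isOpen
  obtain ⟨g, hg⟩ : ∃ g : G, Subgroup.zpowers (g : G ⧸ N.toSubgroup) = ⊤ := by
    have : IsCyclic (G ⧸ N.toSubgroup) := isCyclic_of_prime_card (p := p) hi
    obtain ⟨q, hq⟩ := IsCyclic.exists_generator (α := G ⧸ N.toSubgroup)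
    obtain ⟨g, rfl⟩ := QuotientGroup.mk_surjective q
    exact ⟨g, (Subgroup.eq_top_iff' _).mpr hq⟩
  have hfgN : TopologicallyFG N.toSubgroup := hfg.openSubgroup N.toOpenSubgroup
  have := TopologicalAbelianization.module_finite p hfg
  have := TopologicalAbelianization.module_finite p hfgN
  let K := abInvariants N.toSubgroup
  let j := TopologicalAbelianization.map N.toSubgroup.subtype continuous_subtype_val
  have hjk : Nat.card j.ker = K.index := card_ker_map_subtype hg hNcl
  have hjc : j.range.index = p := (index_range_map_subtype hg hNcl).trans hi
  have hjfin : Finite j.ker := by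
    refine PadicInt.finite_ker_of_finrank_eq p
      (TopologicalAbelianization.linearMap p N.toSubgroup.subtype continuous_subtype_val) ?_ ?_
    · rw [← tfRank_eq_finrank, ← tfRank_eq_finrank, hr]
    · intro x
      have h : Additive.toMul x ^ p ∈ j.range := by
        rw [← hjc]
        exact Subgroup.pow_index_mem _ _
      exact h
  have hK0 : K.index ≠ 0 := hjk ▸ Nat.card_pos.ne'
  -- The `p`-th power map on `N^ab` and on its invariants.
  have hB := PadicInt.card_ker_nsmul_mul_pow_finrank p
    (M := Additive (TopologicalAbelianization N.toSubgroup))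
  rw [← tfRank_eq_finrank, hr] at hB
  let β := powMonoidHom (α := TopologicalAbelianization N.toSubgroup) p
  obtain ⟨hβk, hβ⟩ : Nat.card β.ker ≠ 0 ∧ Nat.card β.ker * p ^ tfRank p G = β.range.index := hB
  have hβc : β.range.index ≠ 0 := hβ ▸ mul_ne_zero hβk (pow_ne_zero _ hp0)
  have hιk : Nat.card K.subtype.ker = 1 := by rw [Subgroup.ker_subtype, Subgroup.card_bot]
  have hιc : K.subtype.range.index = K.index := by rw [Subgroup.range_subtype]
  have hιk0 : Nat.card K.subtype.ker ≠ 0 := hιk ▸ one_ne_zero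
  have hιc0 : K.subtype.range.index ≠ 0 := hιc ▸ hK0
  let α := powMonoidHom (α := K) p
  have hsemi : K.subtype.comp α = β.comp K.subtype := by ext x : 1; rfl
  have hα : Nat.card α.ker * p ^ tfRank p G = α.range.index := by
    have h := MonoidHom.card_ker_mul_index_of_semiconj hsemi hιk0 hιc0 hβk hβc
    rw [← hβ] at h
    refine Nat.eq_of_mul_eq_mul_left (Nat.pos_of_ne_zero hβk) (Eq.trans ?_ h)
    ring
  have hαk : Nat.card α.ker ≠ 0 := by
    have h := MonoidHom.card_ker_comp_ne_zero hιk0 hβk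
    rw [← hsemi, MonoidHom.card_ker_comp] at h
    exact left_ne_zero_of_mul h
  have hαc : α.range.index ≠ 0 := hα ▸ mul_ne_zero hαk (pow_ne_zero _ hp0)
  -- The `p`-th power map on the invariants factors through the transfer.
  let i := abTransferInvariants N
  let h := j.comp K.subtype
  have hjk0 : Nat.card j.ker ≠ 0 := Nat.card_pos.ne'
  have hjc0 : j.range.index ≠ 0 := hjc ▸ hp0
  have hhk : Nat.card h.ker ≠ 0 := MonoidHom.card_ker_comp_ne_zero hιk0 hjk0
  have hhc : h.range.index ≠ 0 := MonoidHom.index_range_comp_ne_zero hιc0 hjc0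
  have hh : Nat.card h.ker * p = h.range.index := by
    have e := MonoidHom.card_ker_comp_mul_index K.subtype j
    rw [hιk, hιc, hjk, hjc, one_mul] at e
    refine Nat.eq_of_mul_eq_mul_left (Nat.pos_of_ne_zero hK0) (Eq.trans ?_ e)
    ring
  have hfac : α = i.comp h := by
    ext b : 1
    exact ((abTransferInvariants_map_subtype N b).trans (by rw [hi]; rfl)).symm
  have hik : Nat.card (transferKernel N) = Nat.card i.ker := by
    rw [show i.ker = (abTransfer N).ker from MonoidHom.ker_codRestrict _ _ _]
  have hic : Nat.card (TransferCokernel N) = i.range.index := rfl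
  have e := MonoidHom.card_ker_comp_mul_index h i
  rw [← hfac, ← hα, ← hh] at e
  rw [hik, hic]
  refine ⟨MonoidHom.card_ker_ne_zero_of_comp (hfac ▸ hαk) hhc,
    MonoidHom.index_range_ne_zero_of_comp (hfac ▸ hαc), ?_⟩
  refine Nat.eq_of_mul_eq_mul_left (Nat.pos_of_ne_zero (mul_ne_zero hαk hhk)) (Eq.trans ?_
    (e.symm.trans ?_)) <;> ring

end Ratio

theorem OpenPSection.card_transferKernel_mul_pow {p : ℕ} [Fact p.Prime] {G : Type*} [Group G]
    [TopologicalSpace G] [IsTopologicalGroup G] [CompactSpace G] [T2Space G]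
    [TotallyDisconnectedSpace G] [IsProP p G] (hfg : TopologicallyFG G)
    (hG : IsOfGlobalTfRank p G) (S : OpenPSection p G) :
    Nat.card (transferKernel S.normalSubgroup) ≠ 0 ∧
      Nat.card (TransferCokernel S.normalSubgroup) ≠ 0 ∧
      Nat.card (transferKernel S.normalSubgroup) * p ^ tfRank p G =
        p * Nat.card (TransferCokernel S.normalSubgroup) := by
  have hV : tfRank p S.normalSubgroup.toSubgroup = tfRank p S.V.toSubgroup :=
    tfRank_congr p (Subgroup.subgroupOfEquivOfLe S.le)
      (Continuous.subtype_mk (continuous_subtype_val.comp continuous_subtype_val) _)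
      (Continuous.subtype_mk (Continuous.subtype_mk continuous_subtype_val _) _)
  have h := _root_.card_transferKernel_mul_pow (p := p) (hfg.openSubgroup S.U) S.normalSubgroup
    S.relIndex_eq (hV.trans ((hG S.V).trans (hG S.U).symm))
  rwa [hG S.U] at h

/-- For a finitely generated pro-`p` group `G` of global tf-rank, `gtf(G) = tf(G)` equals
`1 - log_p ρ(U/V)` for every open `p`-section `(U, V)`, and it is non-negative; the transfer
kernel and cokernel are finite, so that the ratio is meaningful, and the ratio does not depend on
the section. -/
theorem mainTheorem9 (p : ℕ) [Fact p.Prime] (G : Type*) [Group G] [TopologicalSpace G]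
    [IsTopologicalGroup G] [CompactSpace G] [T2Space G] [TotallyDisconnectedSpace G]
    [IsProP p G] (hfg : TopologicallyFG G) (hG : IsOfGlobalTfRank p G) :
    (∀ S : OpenPSection p G,
      Finite (transferKernel S.normalSubgroup) ∧
      Finite (TransferCokernel S.normalSubgroup) ∧
      (tfRank p G : ℝ) = 1 - Real.logb p (transferRatio S.normalSubgroup : ℝ) ∧
      0 ≤ 1 - Real.logb p (transferRatio S.normalSubgroup : ℝ)) ∧
    ∀ S S' : OpenPSection p G,
      transferRatio S.normalSubgroup = transferRatio S'.normalSubgroup := by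
  have hp := (Fact.out : p.Prime)
  have hratio : ∀ S : OpenPSection p G,
      transferRatio S.normalSubgroup = (p : ℚ) / (p : ℚ) ^ tfRank p G := fun S => by
    obtain ⟨-, hc, h⟩ := S.card_transferKernel_mul_pow hfg hG
    rw [transferRatio, div_eq_div_iff (Nat.cast_ne_zero.mpr hc)
      (pow_ne_zero _ (Nat.cast_ne_zero.mpr hp.ne_zero))]
    exact_mod_cast h
  refine ⟨fun S => ?_, fun S S' => (hratio S).trans (hratio S').symm⟩
  obtain ⟨hk, hc, -⟩ := S.card_transferKernel_mul_pow hfg hG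
  have hlog : (tfRank p G : ℝ) = 1 - Real.logb p (transferRatio S.normalSubgroup : ℝ) := by
    have hp0 : (p : ℝ) ≠ 0 := Nat.cast_ne_zero.mpr hp.ne_zero
    have hp1 : (1 : ℝ) < p := Nat.one_lt_cast.mpr hp.one_lt
    rw [hratio S]
    push_cast
    rw [Real.logb_div hp0 (pow_ne_zero _ hp0), Real.logb_pow, Real.logb_self_eq_one hp1]
    ring
  exact ⟨Nat.finite_of_card_ne_zero hk, Nat.finite_of_card_ne_zero hc, hlog,
    hlog ▸ Nat.cast_nonneg _⟩
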